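/- **Lazy shelf shuffler.** Let $n\ge 1$ and $m\ge 0$. The cards $1,\dots,n$ are dealt one at a time, card $1$ first, onto shelves $0,1,\dots,m$. Independently for each card, one of $2m+1$ placements is chosen uniformly at random: at the bottom of shelf $0$, or at the top or at the bottom of one of the shelves $1,\dots,m$ (that is, above or below all cards already on that shelf). At the end the piles are stacked, shelf $0$ on top, followed by shelf $1$, shelf $2$, and so on, and $x_m(\pi)$ denotes the probability that the deck reads $\pi(1),\dots,\pi(n)$ from top to bottom, for $\pi\in S_n$. Let $U(\pi)=1/n!$ be the uniform distribution on $S_n$ and put $$\|x_m-U\|_\infty=\max_{\pi\in S_n}\left|1-\frac{x_m(\pi)}{U(\pi)}\right|,\qquad \mathrm{sep}(x_m)=\max_{\pi\in S_n}\left(1-\frac{x_m(\pi)}{U(\pi)}\right).$$ **Theorem.** (1) Let $0<c<\infty$ be fixed and let $m=m(n)$ be non-negative integers with $m=cn^{3/2}$ up to lower order terms, i.e. $m(n)/n^{3/2}\to c$ as $n\to\infty$ (for example $m=\lfloor cn^{3/2}\rfloor$). Then, as $n\to\infty$, $$\|x_m-U\|_\infty\sim e^{1/(12c^2)}-1,\qquad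 \mathrm{sep}(x_m)\sim 1-e^{-1/(24c^2)}.$$ (2) Consequently order $n^{3/2}$ shelves are necessary and sufficient for randomness: * (sufficient) for every $\varepsilon>0$ there is $C>0$ such that for all sufficiently large $n$ and all $m\ge Cn^{3/2}$ one has $\|x_m-U\|_\infty\le\varepsilon$ and $\mathrm{sep}(x_m)\le\varepsilon$; * (necessary) for every $\varepsilon>0$ there is $c>0$ such that for all sufficiently large $n$ and all $m\le cn^{3/2}$ one has $\|x_m-U\|_\infty\ge 1/\varepsilon$ and $\mathrm{sep}(x_m)\ge 1-\varepsilon$. -/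

import Mathlib

open Filter Topology Asymptotics

namespace LazyShelf

/-- A possible placement of one card by the lazy shelf shuffler with `m` ordinary shelves:
`none` is the bottom of the lazy shelf 0, `some (s, true)` is the top and `some (s, false)` the
bottom of the ordinary shelf `s`. There are `2 * m + 1` placements. -/
abbrev Placement (m : ℕ) : Type := Option (Fin m × Bool)

/-- The contents of the shelves, each listed from top to bottom; `none` is the lazy shelf 0 and
`some s` is the ordinary shelf `s`. The cards are labelled by `Fin n`. -/
abbrev Shelves (n m : ℕ) : Type := Option (Fin m) → List (Fin n)

/-- Put the card `i` where the placement says. -/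
def place {n m : ℕ} (S : Shelves n m) (i : Fin n) : Placement m → Shelves n m
  | none => Function.update S none (S none ++ [i])
  | some (s, true) => Function.update S (some s) (i :: S (some s))
  | some (s, false) => Function.update S (some s) (S (some s) ++ [i])

/-- The shelves after all cards have been dealt, from the top of the deck (card `0` first),
card `i` being placed according to `ω i`. -/
def fill {n m : ℕ} (ω : Fin n → Placement m) : Shelves n m :=
  (List.finRange n).foldl (fun S i => place S i (ω i)) (fun _ => [])

/-- The shuffled deck, read from top to bottom: first the lazy shelf, then the ordinary shelves in
order. -/
def deck {n m : ℕ} (ω : Fin n → Placement m) : List (Fin n) :=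
  fill ω none ++ (List.finRange m).flatMap (fun s => fill ω (some s))

/-- The lazy shelf shuffling measure on permutations of `n` cards with `m` ordinary shelves: the
placements of the cards are independent and uniform, and `prob n m π` is the probability that
the shuffled deck reads `π 0, π 1, …, π (n - 1)` from top to bottom. -/
noncomputable def prob (n m : ℕ) (π : Equiv.Perm (Fin n)) : ℝ :=
  ((Finset.univ.filter
      (fun ω : Fin n → Placement m => deck ω = List.ofFn π)).card : ℝ) / (2 * (m : ℝ) + 1) ^ n

/-- The uniform distribution on permutations of `n` cards. -/
noncomputable def unif (n : ℕ) (_π : Equiv.Perm (Fin n)) : ℝ := 1 / (n.factorial : ℝ)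

/-- The separation distance from uniform, the maximum of `1 - P π / U π`. -/
noncomputable def sep {n : ℕ} (P : Equiv.Perm (Fin n) → ℝ) : ℝ :=
  Finset.univ.sup' Finset.univ_nonempty (fun π => 1 - P π / unif n π)

/-- The `l_∞` distance from uniform, the maximum of `|1 - P π / U π|`. -/
noncomputable def linftyDist {n : ℕ} (P : Equiv.Perm (Fin n) → ℝ) : ℝ :=
  Finset.univ.sup' Finset.univ_nonempty (fun π => |1 - P π / unif n π|)

end LazyShelf

/-! The final deck splits into `2m+1` blocks, increasing and decreasing in turn, so a permutation
arises from the weakly increasing block sequences whose repetitions respect its ascents and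
descents. Counting these by generating functions over `m`, one position at a time, gives `(4X)^L
(1+X)^(n-2L) / (1-X)^(n+1)`, where `L` is the number of left peaks (`evenSeries_eq_peakSeries`).
Since `(1+X)^2 = 4X + (1-X)^2`, fewer left peaks means more placements. The extremes are thus the
identity (`L = 0`) and `1, 0, 3, 2, …` (`L = n/2`), and both distances are explicit in their ratios
to uniform (`sep_prob`, `linftyDist_prob`). With `x = 2m+1`, the differential equations of the
series give `a (n+2) = a (n+1) + ((n+1)/x)^2 a n` for the largest ratio and the product of `1 -
((2i+1)/x)^2` over `i < n/2` for the smallest. Their logarithms are close to `∑ k^2/x^2`, about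
`n^3/(3x^2)`, and to minus `∑ (2i+1)^2/x^2`, about `n^3/(6x^2)`; with `x ~ 2c n^(3/2)` these tend to
`1/(12c^2)` and `-1/(24c^2)`. -/

namespace LazyShelf

/-! ### Generating functions indexed by left peaks, and their recurrences. -/

section Series

open PowerSeries

/-- The geometric series `1 / (1 - X)`. -/
noncomputable def geom : ℝ⟦X⟧ := PowerSeries.mk 1

lemma one_sub_X_mul_geom : (1 - X) * geom = 1 := by
  rw [mul_comm]; exact PowerSeries.mk_one_mul_one_sub_eq_one ℝ

lemma derivative_geom : d⁄dX ℝ geom = geom ^ 2 := by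
  have h := congrArg (d⁄dX ℝ) one_sub_X_mul_geom
  simp only [Derivation.leibniz, map_sub, Derivation.map_one_eq_zero, derivative_X, smul_eq_mul] at h
  linear_combination geom * h - (d⁄dX ℝ geom) * one_sub_X_mul_geom

/-- The generating function, over the number of shelves, of the shelf counts of a permutation of
`2 * L + r` cards with `L` left peaks. -/
noncomputable def peakSeries (L r : ℕ) : ℝ⟦X⟧ := (4 * X) ^ L * (1 + X) ^ r * geom ^ (2 * L + r + 1)

/-- The number of placements that lead to a given permutation of `2 * L + r` cards with `L` left
peaks, for `m` shelves. -/
noncomputable def peakCoeff (m L r : ℕ) : ℝ := coeff m (peakSeries L r)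

lemma coeff_mul_nonneg {f g : ℝ⟦X⟧} (hf : ∀ m, 0 ≤ coeff m f) (hg : ∀ m, 0 ≤ coeff m g) (m : ℕ) :
    0 ≤ coeff m (f * g) := by
  rw [coeff_mul]
  exact Finset.sum_nonneg fun p _ => mul_nonneg (hf _) (hg _)

lemma coeff_pow_nonneg {f : ℝ⟦X⟧} (hf : ∀ m, 0 ≤ coeff m f) (k m : ℕ) :
    0 ≤ coeff m (f ^ k) := by
  induction k generalizing m with
  | zero => rw [pow_zero, coeff_one]; split_ifs <;> norm_num
  | succ k ih => rw [pow_succ]; exact coeff_mul_nonneg ih hf m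

lemma peakCoeff_nonneg (m L r : ℕ) : 0 ≤ peakCoeff m L r := by
  have hX : ∀ m, 0 ≤ coeff m (X : ℝ⟦X⟧) := fun m => by
    rw [coeff_X]; split_ifs <;> norm_num
  have h1 : ∀ m, 0 ≤ coeff m (1 : ℝ⟦X⟧) := fun m => by
    rw [coeff_one]; split_ifs <;> norm_num
  refine coeff_mul_nonneg (coeff_mul_nonneg (coeff_pow_nonneg ?_ _) (coeff_pow_nonneg ?_ _))
    (coeff_pow_nonneg ?_ _) m
  · intro m
    rw [← map_ofNat (C (R := ℝ)) 4, coeff_C_mul]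
    exact mul_nonneg (by norm_num) (hX m)
  · intro m
    rw [map_add]
    exact add_nonneg (h1 m) (hX m)
  · intro m
    simp [geom]

/-- This is `(1+X)^2 = 4X + (1-X)^2` divided by `(1-X)^2`. As coefficients are nonnegative, trading
two factors `1+X` for one `4X` can only lower the count. -/
lemma peakCoeff_add_two (m L r : ℕ) :
    peakCoeff m L (r + 2) = peakCoeff m (L + 1) r + peakCoeff m L r := by
  have h : peakSeries L (r + 2) = peakSeries (L + 1) r + peakSeries L r := by
    simp only [peakSeries]
    have e1 : geom ^ (2 * (L + 1) + r + 1) = geom ^ (2 * L + r + 1) * geom ^ 2 := by ring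
    have e2 : geom ^ (2 * L + (r + 2) + 1) = geom ^ (2 * L + r + 1) * geom ^ 2 := by ring
    rw [e1, e2, pow_succ _ L, pow_add _ r]
    linear_combination (4 * X) ^ L * (1 + X) ^ r * geom ^ (2 * L + r + 1) *
      ((1 - X) * geom + 1) * one_sub_X_mul_geom
  rw [peakCoeff, h, map_add]; rfl

/-- The operator `2X d/dX + 1` therefore multiplies the coefficients by `2m+1`, the number of
placements of a card. -/
lemma coeff_X_mul_derivative (f : ℝ⟦X⟧) (m : ℕ) : coeff m (X * d⁄dX ℝ f) = m * coeff m f := by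
  cases m with
  | zero => simp
  | succ m => rw [coeff_succ_X_mul, coeff_derivative]; push_cast; ring

lemma coeff_natCast_mul (m k : ℕ) (f : ℝ⟦X⟧) :
    coeff m ((k : ℝ⟦X⟧) * f) = k * coeff m f := by
  rw [← map_natCast (C (R := ℝ)) k, coeff_C_mul]

lemma X_mul_derivative_pow (L : ℕ) :
    X * d⁄dX ℝ ((4 * X : ℝ⟦X⟧) ^ L) = (L : ℝ⟦X⟧) * (4 * X) ^ L := by
  have h4 : d⁄dX ℝ (4 : ℝ⟦X⟧) = 0 := by
    rw [← map_ofNat (C (R := ℝ)) 4, derivative_C]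
  cases L with
  | zero => rw [pow_zero, Derivation.map_one_eq_zero, mul_zero, Nat.cast_zero, zero_mul]
  | succ L =>
    rw [Derivation.leibniz_pow, Derivation.leibniz, h4, derivative_X]
    simp only [smul_eq_mul, nsmul_eq_mul, Nat.add_sub_cancel]
    ring

lemma derivative_one_add_X_pow (r : ℕ) :
    d⁄dX ℝ ((1 + X : ℝ⟦X⟧) ^ (r + 1)) = ((r : ℝ⟦X⟧) + 1) * (1 + X) ^ r := by
  rw [Derivation.leibniz_pow, map_add, Derivation.map_one_eq_zero, derivative_X]
  simp only [smul_eq_mul, nsmul_eq_mul, Nat.add_sub_cancel]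
  push_cast; ring

lemma derivative_geom_pow (s : ℕ) :
    d⁄dX ℝ (geom ^ (s + 1)) = ((s : ℝ⟦X⟧) + 1) * geom ^ (s + 2) := by
  rw [Derivation.leibniz_pow, derivative_geom]
  simp only [smul_eq_mul, nsmul_eq_mul, Nat.add_sub_cancel]
  push_cast; ring

lemma peakCoeff_recurrence_zero (m L : ℕ) :
    (2 * (m : ℝ) + 1) * peakCoeff m L 0 = (2 * L + 1) * peakCoeff m L 1 := by
  have h : ((2 : ℕ) : ℝ⟦X⟧) * (X * d⁄dX ℝ (peakSeries L 0)) + peakSeries L 0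
      = ((2 * L + 1 : ℕ) : ℝ⟦X⟧) * peakSeries L 1 := by
    simp only [peakSeries, pow_zero, mul_one]
    rw [Derivation.leibniz, derivative_geom_pow]
    simp only [smul_eq_mul]
    have := X_mul_derivative_pow L
    have e1 : geom ^ (2 * L + 0 + 2) = geom ^ (2 * L + 0 + 1) * geom := by ring
    rw [e1]
    push_cast
    linear_combination 2 * geom ^ (2 * L + 0 + 1) * this
      - (2 * (L : ℝ⟦X⟧) + 1) * (4 * X) ^ L * geom ^ (2 * L + 0 + 1) * one_sub_X_mul_geom
  have := congrArg (coeff m) h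
  rw [map_add, coeff_natCast_mul, coeff_X_mul_derivative, coeff_natCast_mul] at this
  push_cast at this
  simp only [peakCoeff]
  linear_combination this

/-- Put `w = (1+X)/(1-X)`, so that raising `r` by one multiplies the series by `w`. From `2X/(1-X) =
w - 1` and `2X/(1+X) = 1 - 1/w`, the logarithmic derivative shows that `2X d/dX + 1` acts on
`peakSeries L (r+1)` as multiplication by `(2L+r+2) w - (r+1)/w`. -/
lemma peakCoeff_recurrence (m L r : ℕ) :
    (2 * (m : ℝ) + 1) * peakCoeff m L (r + 1) + (r + 1) * peakCoeff m L r
      = (2 * L + r + 2) * peakCoeff m L (r + 2) := by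
  have h : ((2 : ℕ) : ℝ⟦X⟧) * (X * d⁄dX ℝ (peakSeries L (r + 1))) + peakSeries L (r + 1)
      + ((r + 1 : ℕ) : ℝ⟦X⟧) * peakSeries L r = ((2 * L + r + 2 : ℕ) : ℝ⟦X⟧) * peakSeries L (r + 2) := by
    simp only [peakSeries]
    rw [Derivation.leibniz, derivative_geom_pow, Derivation.leibniz, derivative_one_add_X_pow]
    simp only [smul_eq_mul]
    have := X_mul_derivative_pow L
    have e1 : geom ^ (2 * L + (r + 1) + 2) = geom ^ (2 * L + r + 1) * geom ^ 2 := by ring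
    have e2 : geom ^ (2 * L + (r + 1) + 1) = geom ^ (2 * L + r + 1) * geom := by ring
    have e3 : geom ^ (2 * L + (r + 2) + 1) = geom ^ (2 * L + r + 1) * geom ^ 2 := by ring
    rw [e1, e2, e3, pow_succ _ r, pow_add _ r 2]
    push_cast
    generalize hA : (4 * X : ℝ⟦X⟧) ^ L = A at *
    generalize geom ^ (2 * L + r + 1) = B
    generalize (1 + X : ℝ⟦X⟧) ^ r = D
    have hg := one_sub_X_mul_geom
    linear_combination 2 * D * (1 + X) * B * geom * this
      + A * B * D * (-(2 * (L : ℝ⟦X⟧) + r + 2) * (1 + X) * geom - ((r : ℝ⟦X⟧) + 1)) * hg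
  have := congrArg (coeff m) h
  rw [map_add, map_add, coeff_natCast_mul, coeff_X_mul_derivative, coeff_natCast_mul,
    coeff_natCast_mul] at this
  push_cast at this
  simp only [peakCoeff]
  linear_combination this

lemma peakCoeff_zero_zero (m : ℕ) : peakCoeff m 0 0 = 1 := by
  simp [peakCoeff, peakSeries, geom]

end Series

/-! ### Extremal ratios to uniform and their exponential bounds. -/

lemma peakCoeff_antitone (m L k r : ℕ) : peakCoeff m (L + k) r ≤ peakCoeff m L (r + 2 * k) := by
  induction k generalizing L r with
  | zero => simp
  | succ k ih =>
    calc peakCoeff m (L + (k + 1)) r ≤ peakCoeff m (L + k) (r + 2) := by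
          rw [peakCoeff_add_two]
          exact le_add_of_nonneg_right (peakCoeff_nonneg _ _ _)
      _ ≤ peakCoeff m L (r + 2 + 2 * k) := ih _ _
      _ = _ := by ring_nf

/-- The ratio to uniform of the likeliest permutation of `n` cards. -/
noncomputable def maxRatio (m n : ℕ) : ℝ :=
  n.factorial * peakCoeff m 0 n / (2 * (m : ℝ) + 1) ^ n

/-- The ratio to uniform of the least likely permutation of `2 * k` or `2 * k + 1` cards. -/
noncomputable def minRatio (m k : ℕ) : ℝ :=
  ∏ i ∈ Finset.range k, (1 - (2 * (i : ℝ) + 1) ^ 2 / (2 * (m : ℝ) + 1) ^ 2)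

lemma two_mul_add_one_pos (m : ℕ) : (0 : ℝ) < 2 * (m : ℝ) + 1 := by positivity

lemma maxRatio_zero (m : ℕ) : maxRatio m 0 = 1 := by simp [maxRatio, peakCoeff_zero_zero]

lemma maxRatio_one (m : ℕ) : maxRatio m 1 = 1 := by
  have := two_mul_add_one_pos m
  have h := peakCoeff_recurrence_zero m 0
  rw [peakCoeff_zero_zero] at h
  have h' : peakCoeff m 0 1 = 2 * (m : ℝ) + 1 := by push_cast at h; linarith
  rw [maxRatio, h']
  simp [this.ne']

lemma maxRatio_add_two (m n : ℕ) :
    maxRatio m (n + 2)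
      = maxRatio m (n + 1) + ((n : ℝ) + 1) ^ 2 / (2 * (m : ℝ) + 1) ^ 2 * maxRatio m n := by
  have hx := two_mul_add_one_pos m
  have h := peakCoeff_recurrence m 0 n
  simp only [maxRatio, Nat.factorial_succ]
  push_cast at h ⊢
  generalize 2 * (m : ℝ) + 1 = x at hx h ⊢
  have hy : x ^ n ≠ 0 := by positivity
  rw [pow_add x n 2, pow_succ x n]
  generalize x ^ n = y at hy ⊢
  field_simp
  linear_combination -h

lemma maxRatio_nonneg (m n : ℕ) : 0 ≤ maxRatio m n := by
  have := peakCoeff_nonneg m 0 n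
  unfold maxRatio; positivity

lemma maxRatio_le_succ (m n : ℕ) : maxRatio m n ≤ maxRatio m (n + 1) := by
  cases n with
  | zero => rw [maxRatio_zero, zero_add, maxRatio_one]
  | succ n =>
    rw [maxRatio_add_two]
    exact le_add_of_nonneg_right (mul_nonneg (by positivity) (maxRatio_nonneg _ _))

lemma one_le_maxRatio (m n : ℕ) : 1 ≤ maxRatio m n := by
  induction n with
  | zero => rw [maxRatio_zero]
  | succ n ih => exact ih.trans (maxRatio_le_succ m n)

lemma maxRatio_succ_le (m n : ℕ) :
    maxRatio m (n + 1) ≤ (1 + (n : ℝ) ^ 2 / (2 * (m : ℝ) + 1) ^ 2) * maxRatio m n := by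
  cases n with
  | zero => simp [maxRatio_zero, maxRatio_one]
  | succ n =>
    rw [maxRatio_add_two, add_mul, one_mul]
    push_cast
    gcongr
    exact maxRatio_le_succ m n

lemma maxRatio_le_exp (m n : ℕ) :
    maxRatio m n
      ≤ Real.exp (∑ k ∈ Finset.range n, (k : ℝ) ^ 2 / (2 * (m : ℝ) + 1) ^ 2) := by
  induction n with
  | zero => simp [maxRatio_zero]
  | succ n ih =>
    rw [Finset.sum_range_succ, add_comm (Finset.sum _ _), Real.exp_add]
    refine (maxRatio_succ_le m n).trans (mul_le_mul ?_ ih (maxRatio_nonneg _ _) (Real.exp_pos _).le)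
    rw [add_comm]; exact Real.add_one_le_exp _

/-- Cruder than an exponential bound, but free of any smallness of `n/(2m+1)`; it serves when there
are few shelves. -/
lemma one_add_sum_le_maxRatio (m n : ℕ) :
    1 + ∑ k ∈ Finset.range n, (k : ℝ) ^ 2 / (2 * (m : ℝ) + 1) ^ 2 ≤ maxRatio m n := by
  induction n with
  | zero => simp [maxRatio_zero]
  | succ n ih =>
    rw [Finset.sum_range_succ]
    cases n with
    | zero => simp [maxRatio_one]
    | succ n =>
      rw [maxRatio_add_two, ← add_assoc]
      refine add_le_add ih ?_
      push_cast
      exact le_mul_of_one_le_right (by positivity) (one_le_maxRatio m n)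

lemma exp_div_one_add_le {z : ℝ} (hz : 0 ≤ z) : Real.exp (z / (1 + z)) ≤ 1 + z := by
  have h := Real.add_one_le_exp (-(z / (1 + z)))
  have h1 : -(z / (1 + z)) + 1 = (1 + z)⁻¹ := by field_simp; ring
  rw [h1, Real.exp_neg] at h
  exact (inv_le_inv₀ (by positivity) (Real.exp_pos _)).1 h

lemma exp_neg_div_one_sub_le {z : ℝ} (hz : z < 1) : Real.exp (-(z / (1 - z))) ≤ 1 - z := by
  have h1 : 0 < 1 - z := by linarith
  have h := Real.add_one_le_exp (z / (1 - z))
  have h2 : z / (1 - z) + 1 = (1 - z)⁻¹ := by field_simp; ring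
  rw [h2] at h
  rw [Real.exp_neg]
  exact inv_le_of_inv_le₀ h1 h

/-- One factor `1+η` is lost in replacing the ratio at `k` by the ratio at `k+1` in the recurrence,
the other in `log (1+z) ≥ z/(1+z)`. For `m` of order `n^(3/2)`, `η` can be taken to tend to `0`. -/
lemma exp_le_maxRatio (m n : ℕ) {η : ℝ} (hη : (n : ℝ) ^ 2 / (2 * (m : ℝ) + 1) ^ 2 ≤ η) :
    Real.exp ((∑ k ∈ Finset.range n, (k : ℝ) ^ 2 / (2 * (m : ℝ) + 1) ^ 2) / (1 + η) ^ 2)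
      ≤ maxRatio m n := by
  have hη0 : 0 ≤ η := le_trans (by positivity) hη
  have key : ∀ k, k ≤ n →
      Real.exp ((∑ k ∈ Finset.range k, (k : ℝ) ^ 2 / (2 * (m : ℝ) + 1) ^ 2) / (1 + η) ^ 2)
        ≤ maxRatio m k := by
    intro k
    induction k with
    | zero => intro _; simp [maxRatio_zero]
    | succ k ih =>
      intro hk
      cases k with
      | zero => simp [maxRatio_one]
      | succ k =>
        have ih := ih (by omega)
        rw [Finset.sum_range_succ, add_div, Real.exp_add]
        have hle : ∀ j : ℕ, j ≤ n → (j : ℝ) ^ 2 / (2 * (m : ℝ) + 1) ^ 2 ≤ η := fun j hj =>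
          le_trans (by gcongr) hη
        have hy := hle (k + 1) (by omega)
        set y : ℝ := ((k + 1 : ℕ) : ℝ) ^ 2 / (2 * (m : ℝ) + 1) ^ 2 with hydef
        have hy0 : 0 ≤ y := by positivity
        have h1 : maxRatio m (k + 1) ≤ (1 + η) * maxRatio m k :=
          (maxRatio_succ_le m k).trans (mul_le_mul_of_nonneg_right
            (by linarith [hle k (by omega)]) (maxRatio_nonneg _ _))
        have h2 : maxRatio m (k + 1) / (1 + η) ≤ maxRatio m k := by
          rw [div_le_iff₀ (by positivity)]; linarith
        have h3 : Real.exp (y / (1 + η) ^ 2) ≤ 1 + y / (1 + η) := by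
          refine le_trans (Real.exp_le_exp.2 ?_) (exp_div_one_add_le (z := y / (1 + η)) (by positivity))
          rw [pow_two, ← div_div]
          have : y / (1 + η) ≤ η := (div_le_self hy0 (by linarith)).trans hy
          gcongr
        calc _ ≤ maxRatio m (k + 1) * (1 + y / (1 + η)) := by
              gcongr
              exact maxRatio_nonneg _ _
          _ = maxRatio m (k + 1) + y * (maxRatio m (k + 1) / (1 + η)) := by ring
          _ ≤ maxRatio m (k + 1) + y * maxRatio m k := by gcongr
          _ = maxRatio m (k + 1 + 1) := by rw [maxRatio_add_two, hydef]; push_cast; rfl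
  exact key n le_rfl

lemma minRatio_succ (m k : ℕ) : minRatio m (k + 1)
    = minRatio m k * (1 - (2 * (k : ℝ) + 1) ^ 2 / (2 * (m : ℝ) + 1) ^ 2) :=
  Finset.prod_range_succ _ _

/-- For `r = 0` the two recurrences and `peakCoeff_add_two` eliminate `r = 1` and `r = 2`, leaving a
first-order recurrence in `k`, hence a product. A further odd card does not change the ratio. -/
lemma peakCoeff_minimal (m k : ℕ) :
    (2 * k).factorial * peakCoeff m k 0 / (2 * (m : ℝ) + 1) ^ (2 * k) = minRatio m k ∧
    (2 * k + 1).factorial * peakCoeff m k 1 / (2 * (m : ℝ) + 1) ^ (2 * k + 1) = minRatio m k := by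
  have hx := two_mul_add_one_pos m
  have odd_of_even : ∀ k,
      (2 * k).factorial * peakCoeff m k 0 / (2 * (m : ℝ) + 1) ^ (2 * k) = minRatio m k →
      (2 * k + 1).factorial * peakCoeff m k 1 / (2 * (m : ℝ) + 1) ^ (2 * k + 1)
        = minRatio m k := by
    intro k h
    rw [← h, Nat.factorial_succ, pow_succ]
    have := peakCoeff_recurrence_zero m k
    push_cast
    field_simp
    linear_combination -this
  suffices h : ∀ k,
      (2 * k).factorial * peakCoeff m k 0 / (2 * (m : ℝ) + 1) ^ (2 * k) = minRatio m k from
    ⟨h k, odd_of_even k (h k)⟩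
  intro k
  induction k with
  | zero => simp [peakCoeff_zero_zero, minRatio]
  | succ k ih =>
    rw [minRatio_succ, ← ih]
    have h0 := peakCoeff_recurrence_zero m k
    have h1 := peakCoeff_recurrence m k 0
    have h2 := peakCoeff_add_two m k 0
    rw [show 2 * (k + 1) = 2 * k + 1 + 1 by ring, Nat.factorial_succ, Nat.factorial_succ]
    push_cast at h1 ⊢
    simp only [zero_add, add_zero, one_mul] at h1 h2
    rw [h2] at h1
    generalize 2 * (m : ℝ) + 1 = x at hx h0 h1 ⊢
    have hy : x ^ (2 * k) ≠ 0 := by positivity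
    rw [pow_succ, pow_succ]
    generalize x ^ (2 * k) = y at hy ⊢
    field_simp
    linear_combination (-(2 * (k : ℝ) + 1)) * h1 - x * h0

/-- Factors with `i > m` are negative, so the sign is read off from the coefficient rather than from
the product. -/
lemma minRatio_nonneg (m k : ℕ) : 0 ≤ minRatio m k := by
  rw [← (peakCoeff_minimal m k).1]
  have := peakCoeff_nonneg m k 0
  positivity

lemma minRatio_le_exp (m k : ℕ) : minRatio m k
    ≤ Real.exp (-∑ i ∈ Finset.range k, (2 * (i : ℝ) + 1) ^ 2 / (2 * (m : ℝ) + 1) ^ 2) := by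
  induction k with
  | zero => simp [minRatio]
  | succ k ih =>
    rw [minRatio_succ, Finset.sum_range_succ, neg_add, Real.exp_add]
    refine (mul_le_mul_of_nonneg_left ?_ (minRatio_nonneg m k)).trans
      (mul_le_mul_of_nonneg_right ih (Real.exp_pos _).le)
    linarith [Real.add_one_le_exp (-((2 * (k : ℝ) + 1) ^ 2 / (2 * (m : ℝ) + 1) ^ 2))]

lemma minRatio_le_one (m k : ℕ) : minRatio m k ≤ 1 :=
  (minRatio_le_exp m k).trans (Real.exp_le_one_iff.2 (neg_nonpos.2
    (Finset.sum_nonneg fun _ _ => by positivity)))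

lemma one_sub_sum_le_minRatio (m k : ℕ) :
    1 - ∑ i ∈ Finset.range k, (2 * (i : ℝ) + 1) ^ 2 / (2 * (m : ℝ) + 1) ^ 2 ≤ minRatio m k := by
  induction k with
  | zero => simp [minRatio]
  | succ k ih =>
    rw [minRatio_succ, Finset.sum_range_succ]
    have h : 0 ≤ (2 * (k : ℝ) + 1) ^ 2 / (2 * (m : ℝ) + 1) ^ 2 := by positivity
    nlinarith [mul_le_mul_of_nonneg_right (minRatio_le_one m k) h]

lemma exp_le_minRatio (m k : ℕ) {η : ℝ} (hη : (2 * (k : ℝ)) ^ 2 / (2 * (m : ℝ) + 1) ^ 2 ≤ η)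
    (hη1 : η < 1) :
    Real.exp (-((∑ i ∈ Finset.range k, (2 * (i : ℝ) + 1) ^ 2 / (2 * (m : ℝ) + 1) ^ 2) / (1 - η)))
      ≤ minRatio m k := by
  rw [Finset.sum_div, ← Finset.sum_neg_distrib, Real.exp_sum, minRatio]
  refine Finset.prod_le_prod (fun _ _ => (Real.exp_pos _).le) fun i hi => ?_
  have hi : i + 1 ≤ k := Finset.mem_range.1 hi
  have hi : (i : ℝ) + 1 ≤ k := by exact_mod_cast hi
  have hy : (2 * (i : ℝ) + 1) ^ 2 / (2 * (m : ℝ) + 1) ^ 2 ≤ η := by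
    refine le_trans ?_ hη
    gcongr
    linarith
  refine le_trans (Real.exp_le_exp.2 ?_) (exp_neg_div_one_sub_le (lt_of_le_of_lt hy hη1))
  rw [neg_le_neg_iff]
  have : 0 < 1 - η := by linarith
  gcongr

lemma sum_range_sq_eq (n : ℕ) :
    ∑ k ∈ Finset.range n, (k : ℝ) ^ 2 = n * (n - 1) * (2 * n - 1) / 6 := by
  induction n with
  | zero => simp
  | succ n ih => rw [Finset.sum_range_succ, ih]; push_cast; ring

lemma sum_range_odd_sq_eq (k : ℕ) :
    ∑ i ∈ Finset.range k, (2 * (i : ℝ) + 1) ^ 2 = k * (4 * (k : ℝ) ^ 2 - 1) / 3 := by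
  induction k with
  | zero => simp
  | succ n ih => rw [Finset.sum_range_succ, ih]; push_cast; ring

/-! ### Limits of the extremal ratios for `m ~ c n^(3/2)`. -/

section Limits

variable {c : ℝ} {m : ℕ → ℕ}

lemma rpow_three_halves_sq (n : ℕ) : ((n : ℝ) ^ (3 / 2 : ℝ)) ^ 2 = (n : ℝ) ^ 3 := by
  rw [← Real.rpow_natCast, ← Real.rpow_mul n.cast_nonneg, ← Real.rpow_natCast]
  norm_num

lemma tendsto_rpow_three_halves : Tendsto (fun n : ℕ => (n : ℝ) ^ (3 / 2 : ℝ)) atTop atTop :=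
  (tendsto_rpow_atTop (by norm_num)).comp tendsto_natCast_atTop_atTop

lemma tendsto_cube_div_sq (hc : 0 < c)
    (hm : Tendsto (fun n : ℕ => (m n : ℝ) / (n : ℝ) ^ (3 / 2 : ℝ)) atTop (𝓝 c)) :
    Tendsto (fun n : ℕ => (n : ℝ) ^ 3 / (2 * (m n : ℝ) + 1) ^ 2) atTop (𝓝 (1 / (4 * c ^ 2))) := by
  have h1 : Tendsto (fun n : ℕ => 2 * ((m n : ℝ) / (n : ℝ) ^ (3 / 2 : ℝ))
      + ((n : ℝ) ^ (3 / 2 : ℝ))⁻¹) atTop (𝓝 (2 * c + 0)) :=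
    (hm.const_mul 2).add (tendsto_inv_atTop_zero.comp tendsto_rpow_three_halves)
  have h2 := (h1.pow 2).inv₀ (by positivity)
  have e : ((2 * c + 0) ^ 2)⁻¹ = 1 / (4 * c ^ 2) := by rw [add_zero, mul_pow]; norm_num
  rw [e] at h2
  refine h2.congr' ?_
  filter_upwards [eventually_gt_atTop 0] with n hn
  have hn : (0 : ℝ) < n := by exact_mod_cast hn
  have hp : 0 < (n : ℝ) ^ (3 / 2 : ℝ) := by positivity
  rw [← rpow_three_halves_sq n]
  field_simp

lemma tendsto_sq_div_sq (hc : 0 < c)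
    (hm : Tendsto (fun n : ℕ => (m n : ℝ) / (n : ℝ) ^ (3 / 2 : ℝ)) atTop (𝓝 c)) :
    Tendsto (fun n : ℕ => (n : ℝ) ^ 2 / (2 * (m n : ℝ) + 1) ^ 2) atTop (𝓝 0) := by
  have h := (tendsto_cube_div_sq hc hm).mul
    (tendsto_inv_atTop_zero.comp (tendsto_natCast_atTop_atTop (R := ℝ)))
  rw [mul_zero] at h
  refine h.congr' ?_
  filter_upwards [eventually_gt_atTop 0] with n hn
  have hn : (n : ℝ) ≠ 0 := by positivity
  have := two_mul_add_one_pos (m n)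
  simp only [Function.comp]
  field_simp

lemma tendsto_sum_sq (hc : 0 < c)
    (hm : Tendsto (fun n : ℕ => (m n : ℝ) / (n : ℝ) ^ (3 / 2 : ℝ)) atTop (𝓝 c)) :
    Tendsto (fun n : ℕ => ∑ k ∈ Finset.range n, (k : ℝ) ^ 2 / (2 * (m n : ℝ) + 1) ^ 2) atTop
      (𝓝 (1 / (12 * c ^ 2))) := by
  have hi : Tendsto (fun n : ℕ => ((n : ℝ))⁻¹) atTop (𝓝 0) :=
    tendsto_inv_atTop_zero.comp tendsto_natCast_atTop_atTop
  have h := (tendsto_cube_div_sq hc hm).mul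
    (((hi.const_sub 1).mul (hi.const_sub 2)).div_const 6)
  have e : 1 / (4 * c ^ 2) * ((1 - 0) * (2 - 0) / 6) = 1 / (12 * c ^ 2) := by
    field_simp; norm_num
  rw [e] at h
  refine h.congr' ?_
  filter_upwards [eventually_gt_atTop 0] with n hn
  have hn : (n : ℝ) ≠ 0 := by positivity
  have := two_mul_add_one_pos (m n)
  rw [← Finset.sum_div, sum_range_sq_eq]
  field_simp

lemma tendsto_sum_odd_sq (hc : 0 < c)
    (hm : Tendsto (fun n : ℕ => (m n : ℝ) / (n : ℝ) ^ (3 / 2 : ℝ)) atTop (𝓝 c)) :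
    Tendsto (fun n : ℕ => ∑ i ∈ Finset.range (n / 2),
      (2 * (i : ℝ) + 1) ^ 2 / (2 * (m n : ℝ) + 1) ^ 2) atTop (𝓝 (1 / (24 * c ^ 2))) := by
  have hi : Tendsto (fun n : ℕ => ((n : ℝ))⁻¹) atTop (𝓝 0) :=
    tendsto_inv_atTop_zero.comp tendsto_natCast_atTop_atTop
  have hk : Tendsto (fun n : ℕ => ((n / 2 : ℕ) : ℝ) / n) atTop (𝓝 (1 / 2)) := by
    have hl : Tendsto (fun n : ℕ => 1 / 2 - (n : ℝ)⁻¹) atTop (𝓝 (1 / 2)) := by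
      have := hi.const_sub (1 / 2)
      rwa [sub_zero] at this
    refine tendsto_of_tendsto_of_tendsto_of_le_of_le' hl tendsto_const_nhds ?_ ?_
    · filter_upwards [eventually_gt_atTop 0] with n hn
      have hn : (0 : ℝ) < n := by exact_mod_cast hn
      have h : (n : ℝ) ≤ 2 * (n / 2 : ℕ) + 1 := by exact_mod_cast (by omega : n ≤ 2 * (n / 2) + 1)
      rw [le_div_iff₀ hn, sub_mul, inv_mul_cancel₀ hn.ne']
      linarith
    · filter_upwards [eventually_gt_atTop 0] with n hn
      have hn : (0 : ℝ) < n := by exact_mod_cast hn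
      have h : 2 * ((n / 2 : ℕ) : ℝ) ≤ n := by exact_mod_cast (by omega : 2 * (n / 2) ≤ n)
      rw [div_le_iff₀ hn]
      linarith
  have h := (tendsto_cube_div_sq hc hm).mul
    ((hk.mul (((hk.pow 2).const_mul 4).sub (hi.pow 2))).div_const 3)
  have e : 1 / (4 * c ^ 2) * (1 / 2 * (4 * (1 / 2) ^ 2 - 0 ^ 2) / 3) = 1 / (24 * c ^ 2) := by
    field_simp; norm_num
  rw [e] at h
  refine h.congr' ?_
  filter_upwards [eventually_gt_atTop 0] with n hn
  have hn : (n : ℝ) ≠ 0 := by positivity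
  have := two_mul_add_one_pos (m n)
  rw [← Finset.sum_div, sum_range_odd_sq_eq]
  field_simp

lemma tendsto_maxRatio (hc : 0 < c)
    (hm : Tendsto (fun n : ℕ => (m n : ℝ) / (n : ℝ) ^ (3 / 2 : ℝ)) atTop (𝓝 c)) :
    Tendsto (fun n => maxRatio (m n) n) atTop (𝓝 (Real.exp (1 / (12 * c ^ 2)))) := by
  have hS := tendsto_sum_sq hc hm
  have hη := tendsto_sq_div_sq hc hm
  refine tendsto_of_tendsto_of_tendsto_of_le_of_le ?_ ((Real.continuous_exp.tendsto _).comp hS)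
    (fun n => exp_le_maxRatio (m n) n le_rfl) (fun n => maxRatio_le_exp (m n) n)
  have h := hS.div ((hη.const_add 1).pow 2) (by norm_num)
  simp only [add_zero, one_pow, div_one] at h
  exact (Real.continuous_exp.tendsto _).comp h

lemma tendsto_minRatio (hc : 0 < c)
    (hm : Tendsto (fun n : ℕ => (m n : ℝ) / (n : ℝ) ^ (3 / 2 : ℝ)) atTop (𝓝 c)) :
    Tendsto (fun n => minRatio (m n) (n / 2)) atTop (𝓝 (Real.exp (-1 / (24 * c ^ 2)))) := by
  have hS := tendsto_sum_odd_sq hc hm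
  have hη := tendsto_sq_div_sq hc hm
  rw [neg_div]
  refine tendsto_of_tendsto_of_tendsto_of_le_of_le' ?_
    ((Real.continuous_exp.tendsto _).comp hS.neg)
    ?_ (Eventually.of_forall fun n => minRatio_le_exp (m n) (n / 2))
    (g := fun n : ℕ => Real.exp (-((∑ i ∈ Finset.range (n / 2),
      (2 * (i : ℝ) + 1) ^ 2 / (2 * (m n : ℝ) + 1) ^ 2)
        / (1 - (n : ℝ) ^ 2 / (2 * (m n : ℝ) + 1) ^ 2))))
  · have h := (hS.div (hη.const_sub 1) (by norm_num)).neg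
    simp only [sub_zero, div_one] at h
    exact (Real.continuous_exp.tendsto _).comp h
  · filter_upwards [hη.eventually (gt_mem_nhds one_pos)] with n hn
    refine exp_le_minRatio (m n) (n / 2) ?_ hn
    have h : 2 * ((n / 2 : ℕ) : ℝ) ≤ n := by exact_mod_cast (by omega : 2 * (n / 2) ≤ n)
    gcongr

end Limits

/-! ### Bounds on the exponents valid for every number of shelves. -/

lemma sum_sq_div_le (m n : ℕ) :
    ∑ k ∈ Finset.range n, (k : ℝ) ^ 2 / (2 * (m : ℝ) + 1) ^ 2
      ≤ (n : ℝ) ^ 3 / (2 * (m : ℝ) + 1) ^ 2 := by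
  rw [← Finset.sum_div]
  gcongr
  calc ∑ k ∈ Finset.range n, (k : ℝ) ^ 2 ≤ ∑ k ∈ Finset.range n, (n : ℝ) ^ 2 := by
        refine Finset.sum_le_sum fun k hk => ?_
        have := (Finset.mem_range.1 hk).le
        gcongr
    _ = (n : ℝ) ^ 3 := by simp; ring

lemma sum_odd_sq_div_le (m n : ℕ) :
    ∑ i ∈ Finset.range (n / 2), (2 * (i : ℝ) + 1) ^ 2 / (2 * (m : ℝ) + 1) ^ 2
      ≤ (n : ℝ) ^ 3 / (2 * (m : ℝ) + 1) ^ 2 := by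
  rw [← Finset.sum_div]
  gcongr
  have h : 2 * ((n / 2 : ℕ) : ℝ) ≤ n := by exact_mod_cast (by omega : 2 * (n / 2) ≤ n)
  rw [sum_range_odd_sq_eq]
  set k : ℝ := ((n / 2 : ℕ) : ℝ)
  have hk : 0 ≤ k := Nat.cast_nonneg _
  have h3 : (2 * k) ^ 3 ≤ (n : ℝ) ^ 3 := by gcongr
  nlinarith [pow_nonneg hk 3]

lemma le_sum_sq_div (m : ℕ) {n : ℕ} (hn : 3 ≤ n) :
    (n : ℝ) ^ 3 / (2 * (m : ℝ) + 1) ^ 2 / 54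
      ≤ ∑ k ∈ Finset.range n, (k : ℝ) ^ 2 / (2 * (m : ℝ) + 1) ^ 2 := by
  rw [← Finset.sum_div, div_right_comm]
  gcongr
  rw [sum_range_sq_eq]
  have hn : (3 : ℝ) ≤ n := by exact_mod_cast hn
  have : (n : ℝ) ^ 2 / 9 ≤ (n - 1) * (2 * n - 1) := by nlinarith
  nlinarith

/-- With `k = n/2` rounded down, `n ≤ 3k` and `k(4k^2-1)/3 ≥ k^3 ≥ n^3/27`. The constant `54` is
generous, and shared with `le_sum_sq_div`. -/
lemma le_sum_odd_sq_div (m : ℕ) {n : ℕ} (hn : 3 ≤ n) :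
    (n : ℝ) ^ 3 / (2 * (m : ℝ) + 1) ^ 2 / 54
      ≤ ∑ i ∈ Finset.range (n / 2), (2 * (i : ℝ) + 1) ^ 2 / (2 * (m : ℝ) + 1) ^ 2 := by
  rw [← Finset.sum_div, div_right_comm]
  gcongr
  rw [sum_range_odd_sq_eq]
  have h : (n : ℝ) ≤ 3 * ((n / 2 : ℕ) : ℝ) := by exact_mod_cast (by omega : n ≤ 3 * (n / 2))
  have h1 : (1 : ℝ) ≤ ((n / 2 : ℕ) : ℝ) := by exact_mod_cast (by omega : 1 ≤ n / 2)
  set k : ℝ := ((n / 2 : ℕ) : ℝ)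
  have h3 : (n : ℝ) ^ 3 ≤ (3 * k) ^ 3 := by gcongr
  have h4 : k ≤ k ^ 3 := le_self_pow₀ h1 (by norm_num)
  nlinarith

/-! ### The deck as a list sorted by blocks. -/

section Deck

variable {n m : ℕ}

lemma foldl_place_none (ω : Fin n → Placement m) (l : List (Fin n)) (S : Shelves n m) :
    l.foldl (fun S i => place S i (ω i)) S none = S none ++ l.filter (fun i => ω i = none) := by
  induction l generalizing S with
  | nil => simp
  | cons a l ih =>
    rw [List.foldl_cons, ih]
    rcases h : ω a with _ | ⟨s, _ | _⟩ <;> simp [place, h]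

lemma foldl_place_some (ω : Fin n → Placement m) (l : List (Fin n)) (S : Shelves n m)
    (s : Fin m) :
    l.foldl (fun S i => place S i (ω i)) S (some s)
      = (l.filter (fun i => ω i = some (s, true))).reverse ++ S (some s)
        ++ l.filter (fun i => ω i = some (s, false)) := by
  induction l generalizing S with
  | nil => simp
  | cons a l ih =>
    rw [List.foldl_cons, ih]
    rcases h : ω a with _ | ⟨t, _ | _⟩
    · simp [place, h]
    · by_cases hs : s = t
      · subst hs; simp [place, h]
      · simp [place, h, hs, Ne.symm hs]
    · by_cases hs : s = t
      · subst hs; simp [place, h]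
      · simp [place, h, hs, Ne.symm hs]

lemma fill_none (ω : Fin n → Placement m) :
    fill ω none = (List.finRange n).filter (fun i => ω i = none) := by
  rw [fill, foldl_place_none, List.nil_append]

lemma fill_some (ω : Fin n → Placement m) (s : Fin m) :
    fill ω (some s) = ((List.finRange n).filter (fun i => ω i = some (s, true))).reverse
      ++ (List.finRange n).filter (fun i => ω i = some (s, false)) := by
  rw [fill, foldl_place_some, List.append_nil]

/-- The position, from top to bottom, of the block of the final deck into which a placement
puts a card: blocks with even index are increasing and those with odd index decreasing. -/
def block : Placement m → ℕ
  | none => 0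
  | some (s, true) => 2 * s + 1
  | some (s, false) => 2 * s + 2

lemma block_lt (p : Placement m) : block p < 2 * m + 1 := by
  rcases p with _ | ⟨s, _ | _⟩ <;> simp only [block] <;> omega

lemma block_injective : Function.Injective (block (m := m)) := by
  rintro (_ | ⟨s, _ | _⟩) (_ | ⟨t, _ | _⟩) h <;> simp only [block] at h <;>
    first
      | rfl
      | omega
      | (obtain rfl : s = t := Fin.ext (by omega)); rfl

lemma exists_block_eq {u : ℕ} (hu : u < 2 * m + 1) : ∃ p : Placement m, block p = u := by
  rcases Nat.even_or_odd' u with ⟨k, rfl | rfl⟩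
  · cases k with
    | zero => exact ⟨none, rfl⟩
    | succ k => exact ⟨some (⟨k, by omega⟩, false), rfl⟩
  · exact ⟨some (⟨k, by omega⟩, true), rfl⟩

/-- The order of the cards in the final deck when card `i` lands in block `b i`. -/
def Before (b : Fin n → ℕ) (i j : Fin n) : Prop :=
  b i < b j ∨ b i = b j ∧ if b i % 2 = 1 then j < i else i < j

lemma Before.irrefl (b : Fin n → ℕ) (i : Fin n) : ¬ Before b i i := by
  unfold Before; split_ifs <;> simp

lemma Before.trans {b : Fin n → ℕ} {i j k : Fin n} (h : Before b i j) (h' : Before b j k) :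
    Before b i k := by
  unfold Before at *
  split_ifs at * <;> omega

lemma pairwise_deck (ω : Fin n → Placement m) :
    (deck ω).Pairwise (Before fun i => block (ω i)) := by
  have hlt := List.pairwise_lt_finRange n
  have mem_some : ∀ (s : Fin m) (i : Fin n), i ∈ fill ω (some s) →
      block (ω i) = 2 * s + 1 ∨ block (ω i) = 2 * s + 2 := by
    intro s i hi
    rw [fill_some] at hi
    simp only [List.mem_append, List.mem_reverse, List.mem_filter, decide_eq_true_eq] at hi
    rcases hi with ⟨-, h⟩ | ⟨-, h⟩ <;> simp [h, block]
  have mem_none : ∀ i : Fin n, i ∈ fill ω none → block (ω i) = 0 := by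
    intro i hi
    rw [fill_none] at hi
    simp only [List.mem_filter, decide_eq_true_eq] at hi
    simp [hi.2, block]
  rw [deck, List.pairwise_append]
  refine ⟨?_, ?_, ?_⟩
  · rw [fill_none]
    refine (hlt.sublist List.filter_sublist).imp_of_mem fun {i j} hi hj hij => ?_
    simp only [List.mem_filter, decide_eq_true_eq] at hi hj
    simp [Before, hi.2, hj.2, block, hij]
  · rw [List.pairwise_flatMap]
    refine ⟨fun s _ => ?_, ?_⟩
    · rw [fill_some, List.pairwise_append, List.pairwise_reverse]
      refine ⟨?_, ?_, ?_⟩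
      · refine (hlt.sublist List.filter_sublist).imp_of_mem fun {i j} hi hj hij => ?_
        simp only [List.mem_filter, decide_eq_true_eq] at hi hj
        simp [Before, hi.2, hj.2, block, hij, Nat.add_mod]
      · refine (hlt.sublist List.filter_sublist).imp_of_mem fun {i j} hi hj hij => ?_
        simp only [List.mem_filter, decide_eq_true_eq] at hi hj
        simp [Before, hi.2, hj.2, block, hij]
      · intro i hi j hj
        simp only [List.mem_reverse, List.mem_filter, decide_eq_true_eq] at hi hj
        simp [Before, hi.2, hj.2, block]
    · refine (List.pairwise_lt_finRange m).imp fun {s t} hst i hi j hj => ?_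
      have h1 := mem_some s i hi
      have h2 := mem_some t j hj
      have : (s : ℕ) < t := hst
      exact Or.inl (by dsimp only; omega)
  · intro i hi j hj
    obtain ⟨s, -, hj⟩ := List.mem_flatMap.1 hj
    have h1 := mem_none i hi
    have h2 := mem_some s j hj
    exact Or.inl (by dsimp only; omega)

lemma mem_deck (ω : Fin n → Placement m) (i : Fin n) : i ∈ deck ω := by
  simp only [deck, List.mem_append, List.mem_flatMap, fill_none, fill_some, List.mem_finRange,
    List.mem_filter, List.mem_reverse, true_and, decide_eq_true_eq]
  rcases h : ω i with _ | ⟨s, _ | _⟩ <;> simp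

/-- Both lists contain every card once, and a strict order admits only one sorted arrangement. -/
lemma deck_eq_ofFn_iff (ω : Fin n → Placement m) (π : Equiv.Perm (Fin n)) :
    deck ω = List.ofFn π ↔
      ∀ i j, i < j → Before (fun i => block (ω i)) (π i) (π j) := by
  rw [← List.pairwise_ofFn]
  refine ⟨fun h => h ▸ pairwise_deck ω, fun h => ?_⟩
  have hd : (deck ω).Nodup := by
    refine (pairwise_deck ω).imp ?_
    rintro i j hij rfl
    exact Before.irrefl _ i hij
  have hp : (deck ω).Perm (List.ofFn π) := by
    rw [List.perm_ext_iff_of_nodup hd (List.nodup_ofFn.2 π.injective)]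
    intro i
    simp only [mem_deck, true_iff, List.mem_ofFn]
    exact π.surjective i
  exact hp.eq_of_pairwise
    (fun i j _ _ hij hji => (Before.irrefl _ i (hij.trans hji)).elim) (pairwise_deck ω) h

end Deck

/-! ### Counting compatible block sequences. -/

section Count

/-- The strict upper bound on the block of the previous position when the current position lies in
block `u`; `d` tells whether the permutation descends between the two positions. -/
def blockBound (d : Bool) (u : ℕ) : ℕ := if (u % 2 = 1 ↔ d = true) then u + 1 else u

lemma blockBound_le (d : Bool) (u : ℕ) : blockBound d u ≤ u + 1 := by
  unfold blockBound; split_ifs <;> omega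

/-- The sequences of blocks compatible with the descents `δ`, where `δ k` tells whether there is a
descent between the positions `k - 1` and `k`. -/
def Compatible (δ : ℕ → Bool) {n : ℕ} (b : Fin n → ℕ) : Prop :=
  ∀ i j : Fin n, (j : ℕ) = i + 1 → b i < blockBound (δ j) (b j)

lemma Compatible.monotone {δ : ℕ → Bool} {n : ℕ} {b : Fin n → ℕ} (h : Compatible δ b) :
    Monotone b := by
  suffices H : ∀ d : ℕ, ∀ i j : Fin n, (j : ℕ) = i + d → b i ≤ b j from fun i j hij =>
    H (j - i) i j (by have : (i : ℕ) ≤ j := hij; omega)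
  intro d
  induction d with
  | zero => intro i j hij; rw [Fin.ext hij]
  | succ d ih =>
    intro i j hij
    have h1 := ih i ⟨i + d, by omega⟩ rfl
    have h2 := h ⟨i + d, by omega⟩ j (by simp only; omega)
    have h3 := blockBound_le (δ j) (b j)
    omega

/-- By monotonicity the bound on the last entry but one holds for all earlier entries. In this form
it is a smaller index bound, so counting recurses within `compatibleSeqs`. -/
lemma compatible_succ_iff {δ : ℕ → Bool} {n : ℕ} {b : Fin (n + 1) → ℕ} :
    Compatible δ b ↔ Compatible δ (Fin.init b) ∧
      ∀ i : Fin n, b i.castSucc < blockBound (δ n) (b (Fin.last n)) := by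
  constructor
  · intro h
    have h' : Compatible δ (Fin.init b) := fun i j hij => h i.castSucc j.castSucc hij
    refine ⟨h', fun i => ?_⟩
    have hi := i.isLt
    have h1 : Fin.init b i ≤ Fin.init b ⟨n - 1, by omega⟩ :=
      h'.monotone (Fin.le_def.2 (by simp only; omega))
    have h2 := h (Fin.castSucc ⟨n - 1, by omega⟩) (Fin.last n) (by simp; omega)
    exact lt_of_le_of_lt h1 h2
  · rintro ⟨h1, h2⟩ i j hij
    have hi : (i : ℕ) < n := by have := j.isLt; omega
    obtain ⟨j, rfl⟩ | rfl := j.eq_castSucc_or_eq_last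
    · exact h1 ⟨i, hi⟩ j hij
    · exact h2 ⟨i, hi⟩

open Classical in
/-- The compatible sequences of `n` blocks with index less than `M`. -/
noncomputable def compatibleSeqs (δ : ℕ → Bool) (n M : ℕ) : Finset (Fin n → ℕ) :=
  (Fintype.piFinset fun _ : Fin n => Finset.range M).filter (Compatible δ)

lemma mem_compatibleSeqs {δ : ℕ → Bool} {n M : ℕ} {b : Fin n → ℕ} :
    b ∈ compatibleSeqs δ n M ↔ (∀ i, b i < M) ∧ Compatible δ b := by
  simp [compatibleSeqs]

lemma card_compatibleSeqs_zero (δ : ℕ → Bool) (M : ℕ) : (compatibleSeqs δ 0 M).card = 1 := by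
  rw [Finset.card_eq_one]
  refine ⟨Fin.elim0, Finset.eq_singleton_iff_unique_mem.2 ⟨?_, fun b _ => Subsingleton.elim _ _⟩⟩
  exact mem_compatibleSeqs.2 ⟨fun i => i.elim0, fun i => i.elim0⟩

lemma card_compatibleSeqs_succ (δ : ℕ → Bool) (n M : ℕ) :
    (compatibleSeqs δ (n + 1) M).card
      = ∑ u ∈ Finset.range M, (compatibleSeqs δ n (blockBound (δ n) u)).card := by
  rw [Finset.card_eq_sum_card_fiberwise (f := fun b => b (Fin.last n)) (t := Finset.range M)
    fun b hb => Finset.mem_coe.2 (Finset.mem_range.2 ((mem_compatibleSeqs.1 hb).1 _))]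
  refine Finset.sum_congr rfl fun u hu => ?_
  have hu := Finset.mem_range.1 hu
  have hle := blockBound_le (δ n) u
  refine Finset.card_nbij' (fun b => Fin.init b) (fun b => Fin.snoc b u) ?_ ?_ ?_ ?_
  · intro b hb
    simp only [Finset.coe_filter, Set.mem_ofPred_eq, mem_compatibleSeqs, Finset.mem_coe] at hb ⊢
    obtain ⟨⟨-, hc⟩, rfl⟩ := hb
    obtain ⟨h1, h2⟩ := compatible_succ_iff.1 hc
    exact ⟨h2, h1⟩
  · intro b hb
    simp only [Finset.coe_filter, Set.mem_ofPred_eq, mem_compatibleSeqs, Finset.mem_coe] at hb ⊢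
    rw [compatible_succ_iff]
    simp only [Fin.init_snoc, Fin.snoc_castSucc, Fin.snoc_last, and_true]
    refine ⟨fun i => ?_, hb.2, hb.1⟩
    induction i using Fin.lastCases with
    | last => rw [Fin.snoc_last]; exact hu
    | cast i => rw [Fin.snoc_castSucc]; have := hb.1 i; omega
  · intro b hb
    simp only [Finset.coe_filter, Set.mem_ofPred_eq, mem_compatibleSeqs] at hb
    rw [← hb.2]
    exact Fin.snoc_init_self b
  · intro b hb
    exact Fin.init_snoc (α := fun _ => ℕ) u b

lemma card_compatibleSeqs_bound_zero (δ : ℕ → Bool) {n : ℕ} (hn : n ≠ 0) :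
    (compatibleSeqs δ n 0).card = 0 := by
  obtain ⟨n, rfl⟩ := Nat.exists_eq_succ_of_ne_zero hn
  rw [card_compatibleSeqs_succ, Finset.sum_range_zero]

lemma card_compatibleSeqs_succ_succ (δ : ℕ → Bool) (n M : ℕ) :
    (compatibleSeqs δ (n + 1) (M + 1)).card
      = (compatibleSeqs δ (n + 1) M).card + (compatibleSeqs δ n (blockBound (δ n) M)).card := by
  rw [card_compatibleSeqs_succ, Finset.sum_range_succ, ← card_compatibleSeqs_succ]

/-- The number of left peaks among the first `n` positions, for the descents `δ`. -/
def peaks (δ : ℕ → Bool) : ℕ → ℕ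
  | 0 => 0
  | n + 1 => peaks δ n + if δ n && !δ (n - 1) then 1 else 0

open PowerSeries

/-- The generating function of the compatible sequences with index at most `2 * m`. -/
noncomputable def evenSeries (δ : ℕ → Bool) (n : ℕ) : ℝ⟦X⟧ :=
  PowerSeries.mk fun m => ((compatibleSeqs δ n (2 * m + 1)).card : ℝ)

/-- The generating function of the compatible sequences with index less than `2 * m`. -/
noncomputable def oddSeries (δ : ℕ → Bool) (n : ℕ) : ℝ⟦X⟧ :=
  PowerSeries.mk fun m => ((compatibleSeqs δ n (2 * m)).card : ℝ)

lemma evenSeries_zero (δ : ℕ → Bool) : evenSeries δ 0 = geom := by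
  ext m; simp [evenSeries, geom, card_compatibleSeqs_zero]

section Step

variable {δ : ℕ → Bool} {n : ℕ}

/-- In this and the next three lemmas, the sequences ending in the largest allowed block are split
off. The parity of that block, against ascent or descent, decides whether the previous entry may
equal it; `X` appears when the index bound drops from `2(m+1)` to `2m+1`. -/
lemma evenSeries_succ_of_ascent (h : δ n = false) :
    evenSeries δ (n + 1) = oddSeries δ (n + 1) + evenSeries δ n := by
  ext m
  have e : blockBound (δ n) (2 * m) = 2 * m + 1 := by simp [blockBound, h]
  simp only [evenSeries, oddSeries, map_add, coeff_mk]
  rw [card_compatibleSeqs_succ_succ, e]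
  push_cast; ring

lemma oddSeries_succ_of_ascent (h : δ n = false) :
    oddSeries δ (n + 1) = X * (evenSeries δ (n + 1) + evenSeries δ n) := by
  ext m
  cases m with
  | zero => simp [oddSeries, card_compatibleSeqs_bound_zero]
  | succ m =>
    have e : blockBound (δ n) (2 * m + 1) = 2 * m + 1 := by simp [blockBound, h, Nat.add_mod]
    rw [coeff_succ_X_mul]
    simp only [evenSeries, oddSeries, map_add, coeff_mk]
    rw [show 2 * (m + 1) = 2 * m + 1 + 1 by ring, card_compatibleSeqs_succ_succ, e]
    push_cast; ring

lemma evenSeries_succ_of_descent (h : δ n = true) :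
    evenSeries δ (n + 1) = oddSeries δ (n + 1) + oddSeries δ n := by
  ext m
  have e : blockBound (δ n) (2 * m) = 2 * m := by simp [blockBound, h]
  simp only [evenSeries, oddSeries, map_add, coeff_mk]
  rw [card_compatibleSeqs_succ_succ, e]
  push_cast; ring

lemma oddSeries_succ_of_descent (h : δ n = true) (hn : n ≠ 0) :
    oddSeries δ (n + 1) = X * evenSeries δ (n + 1) + oddSeries δ n := by
  ext m
  cases m with
  -- For `n = 0` the empty sequence would still be counted with no block available.
  | zero => simp [oddSeries, card_compatibleSeqs_bound_zero, hn]
  | succ m =>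
    have e : blockBound (δ n) (2 * m + 1) = 2 * m + 2 := by simp [blockBound, h, Nat.add_mod]
    rw [map_add, coeff_succ_X_mul]
    simp only [evenSeries, oddSeries, coeff_mk]
    rw [show 2 * (m + 1) = 2 * m + 1 + 1 by ring, card_compatibleSeqs_succ_succ, e]
    push_cast; ring

end Step

/-- Write `E`, `O` for the two series. Eliminating the new `O`, an ascent multiplies `E` by
`(1+X)/(1-X)`, while a descent makes it `2O/(1-X)`. Now `O` is `(1+X)E/2` after a descent and `2X
E/(1+X)` after an ascent, so a second descent acts like an ascent and only a left peak brings `4X`.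
The exponent `s` keeps the division by `1+X` implicit. -/
lemma evenSeries_eq_peakSeries {δ : ℕ → Bool} (h0 : δ 0 = false) (n : ℕ) :
    ∃ r, 2 * peaks δ n + r = n ∧ evenSeries δ n = peakSeries (peaks δ n) r ∧
      (δ (n - 1) = true → 2 * oddSeries δ n = (1 + X) * evenSeries δ n) ∧
      (δ (n - 1) = false → n ≠ 0 → ∃ s, r = s + 1 ∧
        oddSeries δ n = 2 * X * ((4 * X) ^ peaks δ n * (1 + X) ^ s * geom ^ (n + 1))) := by
  have hg := one_sub_X_mul_geom
  induction n with
  | zero =>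
    refine ⟨0, rfl, ?_, ?_, ?_⟩
    · simp [evenSeries_zero, peakSeries, peaks]
    -- Here `0 - 1` is `0`, so the premise contradicts `h0`.
    · simp [h0]
    · simp
  | succ n ih =>
    obtain ⟨r, hr, hE, hdesc, hasc⟩ := ih
    rw [Nat.add_sub_cancel]
    have hE' := hE
    rw [peakSeries, hr] at hE'
    cases hd : δ n with
    | false =>
      have e1 := evenSeries_succ_of_ascent hd
      have e2 := oddSeries_succ_of_ascent hd
      have hp : peaks δ (n + 1) = peaks δ n := by simp [peaks, hd]
      have e3 : evenSeries δ (n + 1) = geom * (1 + X) * evenSeries δ n := by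
        linear_combination (-evenSeries δ (n + 1)) * hg + geom * (e1 + e2)
      rw [hp]
      refine ⟨r + 1, by omega, ?_, by simp, fun _ _ => ⟨r, rfl, ?_⟩⟩
      · rw [e3, hE', peakSeries, show 2 * peaks δ n + (r + 1) + 1 = n + 1 + 1 by omega]
        ring
      · rw [e2, e3, hE', pow_succ geom (n + 1)]
        linear_combination (-X * (4 * X) ^ peaks δ n * (1 + X) ^ r * geom ^ (n + 1)) * hg
    | true =>
      have hn : n ≠ 0 := by rintro rfl; simp [h0] at hd
      have e1 := evenSeries_succ_of_descent hd
      have e2 := oddSeries_succ_of_descent hd hn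
      have e3 : evenSeries δ (n + 1) = geom * (2 * oddSeries δ n) := by
        linear_combination (-evenSeries δ (n + 1)) * hg + geom * (e1 + e2)
      have e4 : 2 * oddSeries δ (n + 1) = (1 + X) * evenSeries δ (n + 1) := by
        linear_combination e2 - e1
      cases hd' : δ (n - 1) with
      | false =>
        obtain ⟨s, rfl, hO⟩ := hasc hd' hn
        have hp : peaks δ (n + 1) = peaks δ n + 1 := by simp [peaks, hd, hd']
        rw [hp]
        refine ⟨s, by omega, ?_, fun _ => e4, by simp⟩
        rw [e3, hO, peakSeries, show 2 * (peaks δ n + 1) + s + 1 = n + 1 + 1 by omega]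
        ring
      | true =>
        have hp : peaks δ (n + 1) = peaks δ n := by simp [peaks, hd, hd']
        rw [hp]
        refine ⟨r + 1, by omega, ?_, fun _ => e4, by simp⟩
        rw [e3, hdesc hd', hE', peakSeries, show 2 * peaks δ n + (r + 1) + 1 = n + 1 + 1 by omega]
        ring

lemma card_compatibleSeqs_eq_peakCoeff {δ : ℕ → Bool} (h0 : δ 0 = false) (n m : ℕ) :
    2 * peaks δ n ≤ n ∧ ((compatibleSeqs δ n (2 * m + 1)).card : ℝ)
      = peakCoeff m (peaks δ n) (n - 2 * peaks δ n) := by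
  obtain ⟨r, hr, hE, -⟩ := evenSeries_eq_peakSeries h0 n
  refine ⟨by omega, ?_⟩
  rw [show n - 2 * peaks δ n = r by omega, peakCoeff, ← hE, evenSeries, coeff_mk]

end Count

/-! ### From permutations to left peaks; the extremal permutations. -/

section Permutation

variable {n m : ℕ}

/-- Whether a permutation descends between the positions `k - 1` and `k`. -/
def descent (π : Equiv.Perm (Fin n)) (k : ℕ) : Bool :=
  if h : k < n then decide (π ⟨k, h⟩ < π ⟨k - 1, by omega⟩) else false

lemma descent_zero (π : Equiv.Perm (Fin n)) : descent π 0 = false := by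
  unfold descent; split_ifs <;> simp

lemma before_iff_lt_blockBound (π : Equiv.Perm (Fin n)) (b : Fin n → ℕ) {i j : Fin n}
    (hij : (j : ℕ) = i + 1) :
    Before b (π i) (π j) ↔ b (π i) < blockBound (descent π j) (b (π j)) := by
  have hi : (⟨(j : ℕ) - 1, by omega⟩ : Fin n) = i := Fin.ext (by simp only; omega)
  have hne : (π i : ℕ) ≠ π j := fun h => by
    have := π.injective (Fin.ext h); subst this; omega
  simp only [Before, blockBound, descent, j.isLt, dif_pos, hi, Fin.eta, decide_eq_true_eq, Fin.lt_def]
  split_ifs <;> omega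

/-- `Before` is transitive, so consecutive positions suffice. -/
lemma forall_before_iff_compatible (π : Equiv.Perm (Fin n)) (b : Fin n → ℕ) :
    (∀ i j, i < j → Before b (π i) (π j)) ↔ Compatible (descent π) (b ∘ π) := by
  constructor
  · intro h i j hij
    exact (before_iff_lt_blockBound π b hij).1 (h i j (Fin.lt_def.2 (by omega)))
  · intro h
    suffices H : ∀ d : ℕ, ∀ i j : Fin n, (j : ℕ) = i + d + 1 → Before b (π i) (π j) from
      fun i j hij => H (j - i - 1) i j (by have : (i : ℕ) < j := hij; omega)
    intro d
    induction d with
    | zero => intro i j hij; exact (before_iff_lt_blockBound π b hij).2 (h i j hij)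
    | succ d ih =>
      intro i j hij
      have hlt : (i : ℕ) + d + 1 < n := by omega
      have h2 : (j : ℕ) = (⟨i + d + 1, hlt⟩ : Fin n) + 1 := by simp only; omega
      exact (ih i ⟨i + d + 1, hlt⟩ rfl).trans ((before_iff_lt_blockBound π b h2).2 (h _ j h2))

lemma card_deck_eq (n m : ℕ) (π : Equiv.Perm (Fin n)) :
    (Finset.univ.filter (fun ω : Fin n → Placement m => deck ω = List.ofFn π)).card
      = (compatibleSeqs (descent π) n (2 * m + 1)).card := by
  refine Finset.card_bij (fun ω _ i => block (ω (π i))) ?_ ?_ ?_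
  · intro ω hω
    rw [Finset.mem_filter, deck_eq_ofFn_iff, forall_before_iff_compatible] at hω
    exact mem_compatibleSeqs.2 ⟨fun i => block_lt _, hω.2⟩
  · intro ω _ ω' _ h
    funext i
    have := congrFun h (π.symm i)
    simpa using block_injective this
  · intro b hb
    obtain ⟨hlt, hc⟩ := mem_compatibleSeqs.1 hb
    choose p hp using fun i => exists_block_eq (hlt i)
    have e : (fun i => block (p (π.symm (π i)))) = b := by
      funext i; rw [Equiv.symm_apply_apply, hp]
    refine ⟨fun i => p (π.symm i), ?_, e⟩
    rw [Finset.mem_filter, deck_eq_ofFn_iff, forall_before_iff_compatible]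
    refine ⟨Finset.mem_univ _, ?_⟩
    exact (congrArg (Compatible (descent π)) e).mpr hc

lemma prob_div_unif (n m : ℕ) (π : Equiv.Perm (Fin n)) :
    2 * peaks (descent π) n ≤ n ∧ prob n m π / unif n π
      = n.factorial * peakCoeff m (peaks (descent π) n) (n - 2 * peaks (descent π) n)
        / (2 * (m : ℝ) + 1) ^ n := by
  obtain ⟨h1, h2⟩ := card_compatibleSeqs_eq_peakCoeff (descent_zero π) n m
  refine ⟨h1, ?_⟩
  rw [prob, unif, card_deck_eq, h2, div_div_eq_mul_div, div_one]
  ring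

lemma prob_div_unif_le (n m : ℕ) (π : Equiv.Perm (Fin n)) :
    prob n m π / unif n π ≤ maxRatio m n := by
  obtain ⟨h, e⟩ := prob_div_unif n m π
  rw [e, maxRatio]
  have := peakCoeff_antitone m 0 (peaks (descent π) n) (n - 2 * peaks (descent π) n)
  rw [Nat.sub_add_cancel h, zero_add] at this
  gcongr

lemma minRatio_eq (m n : ℕ) : minRatio m (n / 2)
    = n.factorial * peakCoeff m (n / 2) (n % 2) / (2 * (m : ℝ) + 1) ^ n := by
  obtain ⟨h0, h1⟩ := peakCoeff_minimal m (n / 2)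
  rcases Nat.mod_two_eq_zero_or_one n with h | h
  · rw [← h0, h, show 2 * (n / 2) = n by omega]
  · rw [← h1, h, show 2 * (n / 2) + 1 = n by omega]

lemma minRatio_le_prob_div_unif (n m : ℕ) (π : Equiv.Perm (Fin n)) :
    minRatio m (n / 2) ≤ prob n m π / unif n π := by
  obtain ⟨h, e⟩ := prob_div_unif n m π
  rw [e, minRatio_eq]
  have := peakCoeff_antitone m (peaks (descent π) n) (n / 2 - peaks (descent π) n) (n % 2)
  rw [show peaks (descent π) n + (n / 2 - peaks (descent π) n) = n / 2 by omega,
    show n % 2 + 2 * (n / 2 - peaks (descent π) n) = n - 2 * peaks (descent π) n by omega] at this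
  gcongr

lemma prob_one_div_unif (n m : ℕ) : prob n m 1 / unif n 1 = maxRatio m n := by
  have hδ : ∀ k, descent (1 : Equiv.Perm (Fin n)) k = false := by
    intro k
    unfold descent
    split_ifs
    · simp [Fin.lt_def]
    · rfl
  have hp : ∀ k, peaks (descent (1 : Equiv.Perm (Fin n))) k = 0 := by
    intro k
    induction k with
    | zero => rfl
    | succ k ih => simp [peaks, ih, hδ]
  rw [(prob_div_unif n m 1).2, hp, maxRatio]
  simp

/-- The involution of `Fin n` that exchanges `2 * k` and `2 * k + 1` whenever both exist. -/
def swapPairsFun (n : ℕ) (i : Fin n) : Fin n :=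
  if (i : ℕ) % 2 = 1 then ⟨i - 1, by omega⟩ else if h : (i : ℕ) + 1 < n then ⟨i + 1, h⟩ else i

lemma swapPairsFun_involutive (n : ℕ) : Function.Involutive (swapPairsFun n) := by
  intro i
  have := i.isLt
  apply Fin.ext
  by_cases h1 : (i : ℕ) % 2 = 1
  · have h2 : ((i : ℕ) - 1) % 2 ≠ 1 := by omega
    have h3 : (i : ℕ) - 1 + 1 < n := by omega
    simp only [swapPairsFun, h1, h2, h3, if_true, if_false, dif_pos]
    omega
  · by_cases h2 : (i : ℕ) + 1 < n
    · have h3 : ((i : ℕ) + 1) % 2 = 1 := by omega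
      simp [swapPairsFun, h1, h2, h3]
    · simp [swapPairsFun, h1, h2]

/-- The permutation `1, 0, 3, 2, 5, 4, …`, which has as many left peaks as possible. -/
def swapPairs (n : ℕ) : Equiv.Perm (Fin n) := (swapPairsFun_involutive n).toPerm

lemma descent_swapPairs {n k : ℕ} (hk : k < n) :
    descent (swapPairs n) k = decide (k % 2 = 1) := by
  have hv : ∀ (j : ℕ) (hj : j < n), (swapPairs n ⟨j, hj⟩ : ℕ)
      = if j % 2 = 1 then j - 1 else if j + 1 < n then j + 1 else j := by
    intro j hj
    simp only [swapPairs, Function.Involutive.coe_toPerm, swapPairsFun]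
    split_ifs <;> rfl
  simp only [descent, hk, dif_pos, Fin.lt_def, hv, decide_eq_decide]
  split_ifs <;> omega

lemma prob_swapPairs_div_unif (n m : ℕ) :
    prob n m (swapPairs n) / unif n (swapPairs n) = minRatio m (n / 2) := by
  have hp : ∀ k, k ≤ n → peaks (descent (swapPairs n)) k = k / 2 := by
    intro k
    induction k with
    | zero => intro _; rfl
    | succ k ih =>
      intro hk
      rw [peaks, ih (by omega), descent_swapPairs (by omega), descent_swapPairs (by omega)]
      rcases Nat.mod_two_eq_zero_or_one k with h | h
      · simp [h]; omega
      · have : (k - 1) % 2 = 0 := by omega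
        simp [h, this]; omega
  rw [(prob_div_unif n m _).2, hp n le_rfl, minRatio_eq,
    show n - 2 * (n / 2) = n % 2 by omega]

lemma sep_prob (n m : ℕ) : sep (prob n m) = 1 - minRatio m (n / 2) := by
  apply le_antisymm
  · exact Finset.sup'_le _ _ fun π _ => by linarith [minRatio_le_prob_div_unif n m π]
  · rw [← prob_swapPairs_div_unif]
    exact Finset.le_sup' (fun π => 1 - prob n m π / unif n π) (Finset.mem_univ (swapPairs n))

lemma linftyDist_prob (n m : ℕ) :
    linftyDist (prob n m) = max (maxRatio m n - 1) (1 - minRatio m (n / 2)) := by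
  apply le_antisymm
  · refine Finset.sup'_le _ _ fun π _ => abs_le'.2 ⟨?_, ?_⟩
    · exact le_max_of_le_right (by linarith [minRatio_le_prob_div_unif n m π])
    · exact le_max_of_le_left (by linarith [prob_div_unif_le n m π])
  · apply max_le
    · rw [← prob_one_div_unif]
      refine le_trans ?_ (Finset.le_sup' (fun π => |1 - prob n m π / unif n π|)
        (Finset.mem_univ (1 : Equiv.Perm (Fin n))))
      rw [abs_sub_comm]
      exact le_abs_self _
    · rw [← prob_swapPairs_div_unif]
      exact le_trans (le_abs_self _) (Finset.le_sup' (fun π => |1 - prob n m π / unif n π|)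
        (Finset.mem_univ (swapPairs n)))

end Permutation

/-! ### Asymptotics and bounds for the two distances. -/

lemma tendsto_sep {c : ℝ} (hc : 0 < c) {m : ℕ → ℕ}
    (hm : Tendsto (fun n : ℕ => (m n : ℝ) / (n : ℝ) ^ (3 / 2 : ℝ)) atTop (𝓝 c)) :
    Tendsto (fun n => sep (prob n (m n))) atTop (𝓝 (1 - Real.exp (-1 / (24 * c ^ 2)))) := by
  simp only [sep_prob]
  exact (tendsto_minRatio hc hm).const_sub 1

lemma tendsto_linftyDist {c : ℝ} (hc : 0 < c) {m : ℕ → ℕ}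
    (hm : Tendsto (fun n : ℕ => (m n : ℝ) / (n : ℝ) ^ (3 / 2 : ℝ)) atTop (𝓝 c)) :
    Tendsto (fun n => linftyDist (prob n (m n))) atTop
      (𝓝 (Real.exp (1 / (12 * c ^ 2)) - 1)) := by
  simp only [linftyDist_prob]
  have h := ((tendsto_maxRatio hc hm).sub_const 1).max ((tendsto_minRatio hc hm).const_sub 1)
  rwa [max_eq_left] at h
  -- With `t = 1/(24c^2)`: `e^(2t) - 1 ≥ 2t ≥ t ≥ 1 - e^(-t)`, so the likeliest permutation decides
  -- the maximum.
  have h1 := Real.add_one_le_exp (1 / (12 * c ^ 2))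
  have h2 := Real.add_one_le_exp (-1 / (24 * c ^ 2))
  have h3 : 1 / (12 * c ^ 2) = 2 * (1 / (24 * c ^ 2)) := by field_simp; norm_num
  have h4 : 0 ≤ 1 / (24 * c ^ 2) := by positivity
  rw [neg_div] at h2 ⊢
  linarith

lemma distances_le (n m : ℕ) {s : ℝ} (hs : (n : ℝ) ^ 3 / (2 * (m : ℝ) + 1) ^ 2 ≤ s) :
    linftyDist (prob n m) ≤ Real.exp s - 1 ∧ sep (prob n m) ≤ Real.exp s - 1 := by
  have h1 : maxRatio m n ≤ Real.exp s :=
    (maxRatio_le_exp m n).trans (Real.exp_le_exp.2 ((sum_sq_div_le m n).trans hs))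
  have h2 : 1 - minRatio m (n / 2) ≤ Real.exp s - 1 := by
    linarith [one_sub_sum_le_minRatio m (n / 2), sum_odd_sq_div_le m n, Real.add_one_le_exp s]
  rw [linftyDist_prob, sep_prob]
  exact ⟨max_le (by linarith) h2, h2⟩

lemma le_distances {n : ℕ} (hn : 3 ≤ n) (m : ℕ) {s : ℝ}
    (hs : s ≤ (n : ℝ) ^ 3 / (2 * (m : ℝ) + 1) ^ 2 / 54) :
    s ≤ linftyDist (prob n m) ∧ 1 - Real.exp (-s) ≤ sep (prob n m) := by
  rw [linftyDist_prob, sep_prob]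
  constructor
  · refine le_max_of_le_left ?_
    linarith [one_add_sum_le_maxRatio m n, le_sum_sq_div m hn]
  · have h : minRatio m (n / 2) ≤ Real.exp (-s) := (minRatio_le_exp m (n / 2)).trans
      (Real.exp_le_exp.2 (neg_le_neg (hs.trans (le_sum_odd_sq_div m hn))))
    linarith

end LazyShelf

theorem mainTheorem4 :
    -- the asymptotics for `m = c n ^ (3/2)` shelves (up to rounding, or any `o(n ^ (3/2))`)
    (∀ (c : ℝ), 0 < c → ∀ m : ℕ → ℕ,
      Tendsto (fun n : ℕ => (m n : ℝ) / (n : ℝ) ^ (3 / 2 : ℝ)) atTop (𝓝 c) →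
        ((fun n : ℕ => LazyShelf.linftyDist (LazyShelf.prob n (m n))) ~[atTop]
            (fun _ : ℕ => Real.exp (1 / (12 * c ^ 2)) - 1)) ∧
        ((fun n : ℕ => LazyShelf.sep (LazyShelf.prob n (m n))) ~[atTop]
            (fun _ : ℕ => 1 - Real.exp (-1 / (24 * c ^ 2))))) ∧
    -- order `n ^ (3/2)` shelves are sufficient
    (∀ ε : ℝ, 0 < ε → ∃ C : ℝ, 0 < C ∧ ∀ᶠ n : ℕ in atTop, ∀ m : ℕ,
      C * (n : ℝ) ^ (3 / 2 : ℝ) ≤ (m : ℝ) →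
        LazyShelf.linftyDist (LazyShelf.prob n m) ≤ ε ∧
        LazyShelf.sep (LazyShelf.prob n m) ≤ ε) ∧
    -- order `n ^ (3/2)` shelves are necessary
    (∀ ε : ℝ, 0 < ε → ∃ c : ℝ, 0 < c ∧ ∀ᶠ n : ℕ in atTop, ∀ m : ℕ,
      (m : ℝ) ≤ c * (n : ℝ) ^ (3 / 2 : ℝ) →
        1 / ε ≤ LazyShelf.linftyDist (LazyShelf.prob n m) ∧
        1 - ε ≤ LazyShelf.sep (LazyShelf.prob n m)) := by
  refine ⟨fun c hc m hm => ⟨?_, ?_⟩, fun ε hε => ?_, fun ε hε => ?_⟩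
  · have h : Real.exp (1 / (12 * c ^ 2)) - 1 ≠ 0 :=
      (sub_pos.2 (Real.one_lt_exp_iff.2 (by positivity))).ne'
    exact (isEquivalent_const_iff_tendsto h).2 (LazyShelf.tendsto_linftyDist hc hm)
  · have h : 1 - Real.exp (-1 / (24 * c ^ 2)) ≠ 0 := by
      refine (sub_pos.2 (Real.exp_lt_one_iff.2 ?_)).ne'
      rw [neg_div, neg_lt_zero]
      positivity
    exact (isEquivalent_const_iff_tendsto h).2 (LazyShelf.tendsto_sep hc hm)
  · have hl : 0 < Real.log (1 + ε) := Real.log_pos (by linarith)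
    -- Chosen so that `n^3/(2m+1)^2 ≤ 1/C^2 = log (1+ε)`, which `distances_le` turns into `ε`.
    refine ⟨(√(Real.log (1 + ε)))⁻¹, by positivity, ?_⟩
    filter_upwards [eventually_gt_atTop 0] with n hn m hm
    have hn : (0 : ℝ) < n := by exact_mod_cast hn
    have hs : (n : ℝ) ^ 3 / (2 * (m : ℝ) + 1) ^ 2 ≤ Real.log (1 + ε) := by
      rw [div_le_iff₀ (by positivity), ← LazyShelf.rpow_three_halves_sq]
      rw [inv_mul_le_iff₀ (by positivity)] at hm
      have hm' : (n : ℝ) ^ (3 / 2 : ℝ) ≤ √(Real.log (1 + ε)) * (2 * (m : ℝ) + 1) :=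
        hm.trans (by gcongr; linarith [m.cast_nonneg (α := ℝ)])
      calc _ ≤ (√(Real.log (1 + ε)) * (2 * (m : ℝ) + 1)) ^ 2 := by gcongr
        _ = _ := by rw [mul_pow, Real.sq_sqrt hl.le]
    have h := LazyShelf.distances_le n m hs
    rwa [Real.exp_log (by linarith), add_sub_cancel_left] at h
  -- For large `n` the summand `1` is also at most `√ε n^(3/2)/27`, so `2m+1 ≤ √ε n^(3/2)/9`, and
  -- `54/81 ≤ 1` absorbs the constant of `le_distances`.
  · refine ⟨√ε / 27, by positivity, ?_⟩
    filter_upwards [eventually_ge_atTop 3,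
      LazyShelf.tendsto_rpow_three_halves.eventually_ge_atTop (27 / √ε)] with n hn hlarge m hm
    have hs : 1 / ε ≤ (n : ℝ) ^ 3 / (2 * (m : ℝ) + 1) ^ 2 / 54 := by
      rw [div_div, div_le_div_iff₀ hε (by positivity), ← LazyShelf.rpow_three_halves_sq]
      rw [div_le_iff₀ (by positivity)] at hlarge
      have h1 : 2 * (m : ℝ) + 1 ≤ √ε * (n : ℝ) ^ (3 / 2 : ℝ) / 9 := by linarith
      calc 1 * ((2 * (m : ℝ) + 1) ^ 2 * 54)
          ≤ 1 * ((√ε * (n : ℝ) ^ (3 / 2 : ℝ) / 9) ^ 2 * 54) := by gcongr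
        _ = ((n : ℝ) ^ (3 / 2 : ℝ)) ^ 2 * (√ε) ^ 2 * (54 / 81) := by ring
        _ ≤ ((n : ℝ) ^ (3 / 2 : ℝ)) ^ 2 * ε := by
          rw [Real.sq_sqrt hε.le]
          have : 0 ≤ ((n : ℝ) ^ (3 / 2 : ℝ)) ^ 2 * ε := by positivity
          linarith
    obtain ⟨h1, h2⟩ := LazyShelf.le_distances hn m hs
    refine ⟨h1, le_trans ?_ h2⟩
    have h3 : Real.exp (-(1 / ε)) ≤ ε := by
      rw [Real.exp_neg]
      refine inv_le_of_inv_le₀ hε ?_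
      rw [← one_div]
      linarith [Real.add_one_le_exp (1 / ε)]
    linarith
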